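/- Let $X$ be a proper metric space. A glacial scale on $X$ is a sequence $\mathcal S=\{(K_i,n_i)\}_{i\ge 1}$ of bounded sets $K_i\subset X$ and natural numbers $n_i$ such that for every bounded $B\subset X$ and every $r>0$ there is $i$ with $B\subset K_i$ and $n_i>r$. A finite sequence $x_1,\dots,x_n$ in $X$ is an $\mathcal S$-chain if for each $i\le n-1$ there is $m$ with $x_i,x_{i+1}\notin K_m$ and $d(x_i,x_{i+1})\le n_m$. A function $f:X\to\mathbb R$ is glacially oscillating if for every $\epsilon>0$ there is a glacial scale $\mathcal S$ such that $|f(x_1)-f(x_n)|<\epsilon$ for every $\mathcal S$-chain $x_1,\dots,x_n$. The coarse Freudenthal compactification $CF(X)$ is the compactification of $X$ induced by all continuous glacially oscillating functions $f:X\to[0,1]$, i.e. the closure of the image of $X$ in the cube $[0,1]^{F}$, where $F$ is the set of these functions and $x\mapsto (f(x))_{f\in F}$. Its corona is $CF(X)\setminus X$. For a topological space $Y$ and an exhaustion $K_1\subset K_2\subset\cdots$ of $Y$ by compact sets with $K_i\subset\operatorname{int}(K_{i+1})$ and $\bigcup_i K_i=Y$, a Freudenthal end of $Y$ is a decreasing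 sequence $U_1\supset U_2\supset\cdots$ in which $U_i$ is a connected component of $Y\setminus K_i$. Proposition 5.4. Let $G$ be a finitely generated group, let $d$ be any proper left-invariant metric on $G$, and let $S$ be any finite generating set of $G$. Let $\Sigma(G,S)$ be the Cayley graph (with distinct $g,h\in G$ joined by an edge if and only if $g^{-1}h\in S\cup S^{-1}$), regarded as a topological space via its geometric realization. Then $\Sigma(G,S)$ has an exhaustion by compact sets as above, and for every such exhaustion the number of ends of $G$, that is, the cardinality of the corona $CF(G)\setminus G$ of $(G,d)$, equals the cardinality of the set of Freudenthal ends of $\Sigma(G,S)$. -/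

import Mathlib

section Glacial

variable (X : Type*) [PseudoMetricSpace X]

/-- A glacial scale on a metric space: a sequence of pairs `(K i, n i)` of bounded subsets and
natural numbers such that for every bounded `B` and every `r > 0` some pair of the sequence
satisfies `B ⊆ K i` and `r < n i`. -/
structure GlacialScale where
  K : ℕ → Set X
  n : ℕ → ℕ
  bounded : ∀ i, Bornology.IsBounded (K i)
  exhausts : ∀ B : Set X, Bornology.IsBounded B → ∀ r : ℝ, 0 < r → ∃ i, B ⊆ K i ∧ r < (n i : ℝ)

variable {X}

/-- The condition on two consecutive points of a chain with respect to a glacial scale. -/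
def GlacialScale.Link (S : GlacialScale X) (x y : X) : Prop :=
  ∃ m, x ∉ S.K m ∧ y ∉ S.K m ∧ dist x y ≤ (S.n m : ℝ)

/-- `x` and `y` are the first and the last point of some finite chain `x₁, …, xₙ` (`n ≥ 1`) with
respect to the glacial scale. -/
def GlacialScale.Joined (S : GlacialScale X) (x y : X) : Prop :=
  Relation.ReflTransGen S.Link x y

/-- `f` is glacially oscillating: for every `ε > 0` there is a glacial scale such that `f` differs
by less than `ε` at the two endpoints of every chain. -/
def GlaciallyOscillating (f : X → ℝ) : Prop :=
  ∀ ε : ℝ, 0 < ε → ∃ S : GlacialScale X, ∀ x y, S.Joined x y → |f x - f y| < ε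

variable (X)

/-- The continuous glacially oscillating functions `X → [0, 1]`. -/
def GlacialFunction : Type _ :=
  {f : C(X, unitInterval) // GlaciallyOscillating (fun x => (f x : ℝ))}

/-- The evaluation map of `X` into the cube indexed by all continuous glacially oscillating
functions `X → [0, 1]`. -/
def glacialEval : X → (GlacialFunction X → unitInterval) :=
  fun x f => f.1 x

/-- The coarse Freudenthal compactification `CF(X)` of a proper metric space, i.e. the
compactification induced by all continuous glacially oscillating functions `f : X → [0, 1]`:
the closure of `X` in the cube indexed by these functions. -/
def CoarseFreudenthalCompactification : Set (GlacialFunction X → unitInterval) :=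
  closure (Set.range (glacialEval X))

/-- The coarse Freudenthal corona `CF(X) \ X`. -/
def CoarseFreudenthalCorona : Set (GlacialFunction X → unitInterval) :=
  CoarseFreudenthalCompactification X \ Set.range (glacialEval X)

end Glacial

/-- For a proper metric space the evaluation map is a topological embedding, so that
`CoarseFreudenthalCompactification X` is indeed a compactification of `X`. -/
theorem isEmbedding_glacialEval (X : Type*) [MetricSpace X] [ProperSpace X] :
    Topology.IsEmbedding (glacialEval X) := by
  have hcont : Continuous (glacialEval X) := continuous_pi fun f => f.1.continuous
  -- the bump functions with bounded support
  have key : ∀ (a : X) (r : ℝ), 0 < r → ∃ f : GlacialFunction X,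
      f.1 a = 1 ∧ ∀ x, r ≤ dist x a → f.1 x = 0 := by
    intro a r hr
    have hc : Continuous fun x : X => Set.projIcc (0 : ℝ) 1 zero_le_one (1 - dist x a / r) :=
      continuous_projIcc.comp (by fun_prop)
    have hz : ∀ x, r ≤ dist x a →
        Set.projIcc (0 : ℝ) 1 zero_le_one (1 - dist x a / r) = 0 := by
      intro x hx
      refine Set.projIcc_of_le_left _ ?_
      have : 1 ≤ dist x a / r := (one_le_div hr).2 hx
      linarith
    refine ⟨⟨⟨_, hc⟩, ?_⟩, ?_, hz⟩
    · intro ε hε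
      let S : GlacialScale X :=
        { K := fun i => Metric.ball a (r + i)
          n := fun i => i
          bounded := fun i => Metric.isBounded_ball
          exhausts := by
            intro B hB ρ _
            obtain ⟨R, hR⟩ := hB.subset_ball a
            obtain ⟨i, hi⟩ := exists_nat_gt (max R ρ)
            refine ⟨i, fun x hx => ?_, lt_of_le_of_lt (le_max_right _ _) hi⟩
            exact Metric.ball_subset_ball
              (by have := le_max_left R ρ; linarith) (hR hx) }
      refine ⟨S, fun x y hxy => ?_⟩
      have hout : ∀ {z : X} {m : ℕ}, z ∉ S.K m → r ≤ dist z a := by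
        intro z m hz'
        have h1 : ¬ dist z a < r + m := fun h => hz' (Metric.mem_ball.2 h)
        have h2 : (0 : ℝ) ≤ m := Nat.cast_nonneg m
        linarith
      have hlink : x = y ∨ (r ≤ dist x a ∧ r ≤ dist y a) := by
        induction hxy with
        | refl => exact Or.inl rfl
        | tail _ hl ih =>
          obtain ⟨m, h1, h2, _⟩ := hl
          rcases ih with rfl | ih
          · exact Or.inr ⟨hout h1, hout h2⟩
          · exact Or.inr ⟨ih.1, hout h2⟩
      rcases hlink with rfl | ⟨h1, h2⟩
      · simpa using hε
      · simpa [hz x h1, hz y h2] using hε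
    · change Set.projIcc (0 : ℝ) 1 zero_le_one (1 - dist a a / r) = 1
      exact Set.projIcc_of_right_le _ (by simp)
  refine ⟨⟨le_antisymm hcont.le_induced ?_⟩, ?_⟩
  · rw [le_iff_nhds]
    intro a
    rw [nhds_induced, Metric.nhds_basis_ball.ge_iff]
    intro r hr
    obtain ⟨f, hf1, hf0⟩ := key a r hr
    refine ⟨{p | p f ≠ 0}, ?_, ?_⟩
    · refine (isOpen_ne.preimage (continuous_apply f)).mem_nhds ?_
      change f.1 a ≠ 0
      rw [hf1]
      exact one_ne_zero
    · intro x hx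
      by_contra hxa
      exact hx (hf0 x (not_lt.1 fun h => hxa (Metric.mem_ball.2 h)))
  · intro a b hab
    by_contra hne
    obtain ⟨f, hf1, hf0⟩ := key a (dist b a) (dist_pos.2 (Ne.symm hne))
    have h : f.1 a = f.1 b := congrFun hab f
    rw [hf1, hf0 b le_rfl] at h
    exact one_ne_zero h

/-- The number of ends of a (countable) group equipped with a (proper, left-invariant) metric:
the cardinality of its coarse Freudenthal corona. -/
noncomputable def numberOfEnds (G : Type*) [Group G] [MetricSpace G] : Cardinal :=
  Cardinal.mk (CoarseFreudenthalCorona G)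

open scoped Classical in
/-- The geometric realization of a simple graph: the union, in the space of functions `V → ℝ`, of
all basis vectors (the vertices) and of the straight segments joining the basis vectors of adjacent
vertices (the edges). It carries the subspace topology of the product topology. When the graph is
locally finite, this is the usual topology of the graph as a one-dimensional complex: the points
whose coordinate at `v` is positive form the open star of `v`, which meets finitely many edges. -/
def SimpleGraph.geometricRealization {V : Type*} (Γ : SimpleGraph V) : Set (V → ℝ) :=
  {p | ∃ u v : V, (u = v ∨ Γ.Adj u v) ∧ p ∈ segment ℝ (Pi.single u (1 : ℝ)) (Pi.single v (1 : ℝ))}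

/-- The Freudenthal ends of a space `X` with an exhaustion by compact sets `K i` (so that
`K i ⊆ interior (K (i + 1))` and the union of all `K i` is `X`): the decreasing sequences `U i` of
connected components of `X \ K i`. -/
def FreudenthalEnds {X : Type*} [TopologicalSpace X] (K : CompactExhaustion X) :
    Set (ℕ → Set X) :=
  {U | Antitone U ∧ ∀ i, ∃ x, x ∉ K i ∧ U i = connectedComponentIn (K i)ᶜ x}

/-! Bounded subsets of $G$ are finite: a countable group with a proper left-invariant metric is
discrete. A Freudenthal end $U$ defines a filter on $G$, generated by the vertex sets of the $U_i$,
and the bijection sends $U$ to the limit of $G \to CF(G)$ along this filter.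

The limit exists because edges of the Cayley graph have bounded length: once $U_i$ avoids the stars
of a suitable finite set, its vertices are joined by chains, so a glacially oscillating $f$ varies
by less than $\epsilon$ on them (`exists_tendsto_endFilter`).

Conversely, the vertex set $A$ of a component of the complement of $K_i$ is almost invariant: right
translation by any fixed $g$ changes it by a finite set. By left invariance a step of length at most
$m$ is right multiplication by one of finitely many elements, so the indicator of $A$ is glacially
oscillating (`exists_glacialFunction_indicator`). Such indicators separate different ends; those of
singletons separate the limits from $G$.

For surjectivity, a corona point is the limit along a nonprincipal ultrafilter. Finitely many
components of each complement contain almost all vertices, so the ultrafilter selects one component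
for every $i$, and these form an end. -/

open Set Filter Topology

/-! ### Topology of the geometric realization -/

namespace SimpleGraph

variable {V : Type*} {Γ : SimpleGraph V}

open scoped Classical in
/-- The vertex `v`, as a point of the geometric realization. -/
noncomputable def realizationVertex (Γ : SimpleGraph V) (v : V) : Γ.geometricRealization :=
  ⟨Pi.single v 1, v, v, Or.inl rfl, left_mem_segment ℝ _ _⟩

open scoped Classical in
/-- The points of the geometric realization on the segment from `u` to `v`. -/
def realizationEdge (Γ : SimpleGraph V) (u v : V) : Set Γ.geometricRealization :=
  {p | p.1 ∈ segment ℝ (Pi.single u (1 : ℝ)) (Pi.single v (1 : ℝ))}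

/-- The open star of a vertex in the geometric realization. -/
def realizationStar (Γ : SimpleGraph V) (v : V) : Set Γ.geometricRealization :=
  {p | 0 < p.1 v}

theorem left_mem_realizationEdge (u v : V) :
    Γ.realizationVertex u ∈ Γ.realizationEdge u v :=
  left_mem_segment ℝ _ _

theorem right_mem_realizationEdge (u v : V) :
    Γ.realizationVertex v ∈ Γ.realizationEdge u v :=
  right_mem_segment ℝ _ _

theorem realizationEdge_comm (u v : V) : Γ.realizationEdge u v = Γ.realizationEdge v u := by
  ext p
  exact iff_of_eq (congrArg (p.1 ∈ ·) (segment_symm ℝ _ _))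

theorem exists_mem_realizationEdge (p : Γ.geometricRealization) :
    ∃ u v : V, (u = v ∨ Γ.Adj u v) ∧ p ∈ Γ.realizationEdge u v :=
  p.2

theorem isOpen_realizationStar (v : V) : IsOpen (Γ.realizationStar v) :=
  isOpen_lt continuous_const ((continuous_apply v).comp continuous_subtype_val)

theorem realizationVertex_mem_star (v : V) : Γ.realizationVertex v ∈ Γ.realizationStar v := by
  simp [realizationVertex, realizationStar]

/-- On an edge, every coordinate other than those of its two endpoints vanishes. -/
theorem eq_or_eq_of_mem_star {u v w : V} {p : Γ.geometricRealization}
    (hp : p ∈ Γ.realizationEdge u v) (hw : p ∈ Γ.realizationStar w) : w = u ∨ w = v := by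
  obtain ⟨a, b, -, -, -, h⟩ := hp
  by_contra! hne
  have : p.1 w = 0 := by rw [← h]; simp [hne.1, hne.2]
  exact (ne_of_gt hw) this

open scoped Classical in
theorem mem_star_or_mem_star {u v : V} {p : Γ.geometricRealization}
    (hp : p ∈ Γ.realizationEdge u v) : p ∈ Γ.realizationStar u ∨ p ∈ Γ.realizationStar v := by
  obtain ⟨a, b, ha, hb, hab, h⟩ := hp
  rcases ha.lt_or_eq with ha' | rfl
  · left
    change 0 < p.1 u
    rw [← h]
    have : 0 ≤ b * (Pi.single v (1 : ℝ) : V → ℝ) u :=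
      mul_nonneg hb (by by_cases h : u = v <;> simp [h])
    simpa using add_pos_of_pos_of_nonneg ha' this
  · right
    change 0 < p.1 v
    rw [← h]
    simp [show b = 1 by linarith]

open scoped Classical in
theorem image_realizationEdge {u v : V} (h : u = v ∨ Γ.Adj u v) :
    Subtype.val '' Γ.realizationEdge u v =
      segment ℝ (Pi.single u (1 : ℝ)) (Pi.single v (1 : ℝ)) := by
  ext p
  exact ⟨by rintro ⟨q, hq, rfl⟩; exact hq, fun hp => ⟨⟨p, u, v, h, hp⟩, hp, rfl⟩⟩

theorem isCompact_realizationEdge {u v : V} (h : u = v ∨ Γ.Adj u v) :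
    IsCompact (Γ.realizationEdge u v) := by
  rw [Subtype.isCompact_iff, image_realizationEdge h, segment_eq_image]
  exact isCompact_Icc.image (by fun_prop)

theorem isPreconnected_realizationEdge {u v : V} (h : u = v ∨ Γ.Adj u v) :
    IsPreconnected (Γ.realizationEdge u v) := by
  rw [← IsInducing.subtypeVal.isPreconnected_image, image_realizationEdge h]
  exact (convex_segment _ _).isPreconnected

theorem realizationVertex_mem_connectedComponentIn {u v : V} (h : u = v ∨ Γ.Adj u v)
    {K : Set Γ.geometricRealization} (hK : Disjoint (Γ.realizationEdge u v) K)
    {p : Γ.geometricRealization} (hp : p ∈ Γ.realizationEdge u v) :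
    Γ.realizationVertex u ∈ connectedComponentIn Kᶜ p :=
  (isPreconnected_realizationEdge h).subset_connectedComponentIn hp
    (subset_compl_iff_disjoint_right.2 hK) (left_mem_realizationEdge u v)

/-- The closed star of a vertex, i.e. the union of the edges at this vertex. -/
def realizationClosedStar (Γ : SimpleGraph V) (v : V) : Set Γ.geometricRealization :=
  ⋃ u ∈ insert v (Γ.neighborSet v), Γ.realizationEdge v u

theorem realizationStar_subset_closedStar (v : V) :
    Γ.realizationStar v ⊆ Γ.realizationClosedStar v := by
  intro p hp
  obtain ⟨x, y, hxy, hpe⟩ := exists_mem_realizationEdge p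
  rcases eq_or_eq_of_mem_star hpe hp with rfl | rfl
  · exact mem_biUnion (hxy.imp Eq.symm id) hpe
  · exact mem_biUnion (hxy.imp id Adj.symm) (realizationEdge_comm x v ▸ hpe)

theorem isCompact_realizationClosedStar (hfin : ∀ v, (Γ.neighborSet v).Finite) (v : V) :
    IsCompact (Γ.realizationClosedStar v) :=
  ((hfin v).insert v).isCompact_biUnion fun _ hu =>
    isCompact_realizationEdge ((mem_insert_iff.1 hu).imp Eq.symm id)

theorem iUnion_realizationClosedStar : ⋃ v, Γ.realizationClosedStar v = univ := by
  refine eq_univ_of_forall fun p => mem_iUnion.2 ?_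
  obtain ⟨x, y, -, hpe⟩ := exists_mem_realizationEdge p
  exact (mem_star_or_mem_star hpe).elim (fun h => ⟨x, realizationStar_subset_closedStar x h⟩)
    fun h => ⟨y, realizationStar_subset_closedStar y h⟩

/-- The closed stars are compact, countably many of them cover the space, and they contain the open
stars, which makes them neighborhoods. -/
theorem nonempty_compactExhaustion_geometricRealization [Countable V]
    (hfin : ∀ v, (Γ.neighborSet v).Finite) :
    Nonempty (CompactExhaustion Γ.geometricRealization) := by
  have hc := isCompact_realizationClosedStar hfin
  have : SigmaCompactSpace Γ.geometricRealization :=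
    ⟨iUnion_realizationClosedStar (Γ := Γ) ▸ isSigmaCompact_iUnion_of_isCompact _ hc⟩
  have : WeaklyLocallyCompactSpace Γ.geometricRealization := by
    refine ⟨fun p => ?_⟩
    obtain ⟨x, y, -, hpe⟩ := exists_mem_realizationEdge p
    obtain ⟨v, hv⟩ : ∃ v, p ∈ Γ.realizationStar v :=
      (mem_star_or_mem_star hpe).elim (fun h => ⟨x, h⟩) fun h => ⟨y, h⟩
    exact ⟨_, hc v, mem_of_superset ((isOpen_realizationStar v).mem_nhds hv)
      (realizationStar_subset_closedStar v)⟩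
  exact ⟨default⟩

/-- In a locally finite graph, only finitely many edges meet a given compact set. -/
theorem finite_setOf_realizationEdge_inter_nonempty (hfin : ∀ v, (Γ.neighborSet v).Finite)
    {K : Set Γ.geometricRealization} (hK : IsCompact K) :
    {x | ∃ y, (x = y ∨ Γ.Adj x y) ∧ ¬ Disjoint (Γ.realizationEdge x y) K}.Finite := by
  -- Finitely many open stars cover `K`; an edge meeting `K` has the center of one of them as an
  -- endpoint.
  obtain ⟨T, hT⟩ := hK.elim_finite_subcover Γ.realizationStar isOpen_realizationStar fun p _ => by
    obtain ⟨x, y, -, hpe⟩ := exists_mem_realizationEdge p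
    exact mem_iUnion.2 ((mem_star_or_mem_star hpe).elim (fun h => ⟨x, h⟩) fun h => ⟨y, h⟩)
  refine (T.finite_toSet.biUnion fun v _ => (hfin v).insert v).subset ?_
  rintro x ⟨y, hxy, hd⟩
  obtain ⟨p, hpe, hpK⟩ := not_disjoint_iff.1 hd
  obtain ⟨v, hvT, hv⟩ := mem_iUnion₂.1 (hT hpK)
  refine mem_biUnion hvT ?_
  rcases eq_or_eq_of_mem_star hpe hv with rfl | rfl
  · exact mem_insert _ _
  · exact hxy.imp id Adj.symm

/-- A preconnected set missing the open stars of the vertices in `F` has its vertices in a single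
connected component of the graph minus `F`. -/
theorem mem_of_isPreconnected_of_disjoint_star {F A : Set V}
    (hA : ∀ x ∈ A, ∀ y, x ∉ F → y ∉ F → Γ.Adj x y → y ∈ A)
    {U : Set Γ.geometricRealization} (hU : IsPreconnected U)
    (hUF : ∀ v ∈ F, Disjoint U (Γ.realizationStar v)) {v w : V} (hvA : v ∈ A)
    (hv : Γ.realizationVertex v ∈ U) (hw : Γ.realizationVertex w ∈ U) : w ∈ A := by
  by_contra hwA
  -- The stars centered in `A` and those centered outside `A` form an open cover. A point common to
  -- both kinds lies on an edge leaving `A`, and within `U` neither endpoint of that edge is in `F`.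
  obtain ⟨p, hpU, hpA, hpA'⟩ := hU (⋃ a ∈ A, Γ.realizationStar a) (⋃ a ∈ Aᶜ, Γ.realizationStar a)
    (isOpen_biUnion fun _ _ => isOpen_realizationStar _)
    (isOpen_biUnion fun _ _ => isOpen_realizationStar _)
    (fun p _ => by
      obtain ⟨x, y, -, hpe⟩ := exists_mem_realizationEdge p
      obtain ⟨a, ha⟩ : ∃ v, p ∈ Γ.realizationStar v :=
        (mem_star_or_mem_star hpe).elim (fun h => ⟨x, h⟩) fun h => ⟨y, h⟩
      by_cases h : a ∈ A
      · exact Or.inl (mem_biUnion h ha)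
      · exact Or.inr (mem_biUnion h ha))
    ⟨_, hv, mem_biUnion hvA (realizationVertex_mem_star v)⟩
    ⟨_, hw, mem_biUnion hwA (realizationVertex_mem_star w)⟩
  obtain ⟨a, haA, ha⟩ := mem_iUnion₂.1 hpA
  obtain ⟨b, hbA, hb⟩ := mem_iUnion₂.1 hpA'
  have haF : a ∉ F := fun h => Set.disjoint_left.1 (hUF a h) hpU ha
  have hbF : b ∉ F := fun h => Set.disjoint_left.1 (hUF b h) hpU hb
  have hne : a ≠ b := fun h => hbA (h ▸ haA)
  obtain ⟨x, y, hxy, hpe⟩ := exists_mem_realizationEdge p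
  refine hbA (hA a haA b haF hbF ?_)
  rcases eq_or_eq_of_mem_star hpe ha with rfl | rfl <;>
    rcases eq_or_eq_of_mem_star hpe hb with rfl | rfl
  · exact absurd rfl hne
  · exact hxy.resolve_left hne
  · exact (hxy.resolve_left hne.symm).symm
  · exact absurd rfl hne

/-! ### Freudenthal ends as filters on the vertices -/

/-- The vertices in the members of a Freudenthal end. -/
def endVertices (U : ℕ → Set Γ.geometricRealization) (i : ℕ) : Set V :=
  {v | Γ.realizationVertex v ∈ U i}

/-- The filter on the vertices generated by a Freudenthal end. -/
def endFilter (U : ℕ → Set Γ.geometricRealization) : Filter V :=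
  ⨅ i, 𝓟 (endVertices U i)

variable {K : CompactExhaustion Γ.geometricRealization} {U : ℕ → Set Γ.geometricRealization}

theorem _root_.FreudenthalEnds.eq_connectedComponentIn {X : Type*} [TopologicalSpace X]
    {K : CompactExhaustion X} {U : ℕ → Set X} (hU : U ∈ FreudenthalEnds K) {i : ℕ} {p : X}
    (hp : p ∈ U i) : U i = connectedComponentIn (K i)ᶜ p := by
  obtain ⟨x, -, hx⟩ := hU.2 i
  rw [hx] at hp ⊢
  exact connectedComponentIn_eq hp

theorem _root_.FreudenthalEnds.subset_compl {X : Type*} [TopologicalSpace X]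
    {K : CompactExhaustion X} {U : ℕ → Set X} (hU : U ∈ FreudenthalEnds K) (i : ℕ) :
    U i ⊆ (K i)ᶜ := by
  obtain ⟨x, -, hx⟩ := hU.2 i
  exact hx ▸ connectedComponentIn_subset _ _

theorem antitone_endVertices (hU : U ∈ FreudenthalEnds K) : Antitone (endVertices U) :=
  fun _ _ h _ hv => hU.1 h hv

theorem nonempty_endVertices (hfin : ∀ v, (Γ.neighborSet v).Finite) (hU : U ∈ FreudenthalEnds K)
    (i : ℕ) : (endVertices U i).Nonempty := by
  have hF := finite_setOf_realizationEdge_inter_nonempty hfin (K.isCompact i)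
  -- A point of `U i` may lie on an edge that meets `K i`. Outside this larger `K j` that is
  -- impossible, so the whole edge through the point stays in `U i`, including its endpoints.
  obtain ⟨j, hj⟩ := K.exists_superset_of_isCompact
    (hF.isCompact_biUnion fun v _ => isCompact_realizationClosedStar hfin v)
  obtain ⟨p, hpj, hp⟩ := hU.2 (max i j)
  have hpU : p ∈ U (max i j) := hp ▸ mem_connectedComponentIn hpj
  have hpi : p ∈ U i := hU.1 (le_max_left i j) hpU
  obtain ⟨x, y, hxy, hpe⟩ := exists_mem_realizationEdge p
  refine ⟨x, ?_⟩
  change _ ∈ U i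
  rw [FreudenthalEnds.eq_connectedComponentIn hU hpi]
  refine realizationVertex_mem_connectedComponentIn hxy ?_ hpe
  by_contra hd
  exact hpj (K.subset (le_max_right i j) (hj (mem_biUnion (show x ∈ {x | _} from ⟨y, hxy, hd⟩)
    (mem_biUnion (hxy.imp Eq.symm id) hpe))))

theorem hasBasis_endFilter (hU : U ∈ FreudenthalEnds K) :
    (endFilter U).HasBasis (fun _ => True) (endVertices U) :=
  hasBasis_iInf_principal (antitone_endVertices hU).directed_ge

theorem endVertices_mem_endFilter (U : ℕ → Set Γ.geometricRealization) (i : ℕ) :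
    endVertices U i ∈ endFilter U :=
  mem_iInf_of_mem i (mem_principal_self _)

theorem endFilter_neBot (hfin : ∀ v, (Γ.neighborSet v).Finite) (hU : U ∈ FreudenthalEnds K) :
    (endFilter U).NeBot :=
  (hasBasis_endFilter hU).neBot_iff.2 fun _ => nonempty_endVertices hfin hU _

theorem compl_singleton_mem_endFilter (hU : U ∈ FreudenthalEnds K) (v : V) :
    {v}ᶜ ∈ endFilter U := by
  obtain ⟨i, hi⟩ := K.exists_mem (Γ.realizationVertex v)
  refine mem_of_superset (endVertices_mem_endFilter U i) fun w hw hwv => ?_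
  rw [mem_singleton_iff.1 hwv] at hw
  exact FreudenthalEnds.subset_compl hU i hw hi

/-- A filter on the vertices that contains the vertex set of a component of the complement of each
`K i` is finer than the filter of some Freudenthal end. -/
theorem exists_freudenthalEnd_of_le {l : Filter V} [l.NeBot]
    (hl : ∀ i, ∃ v, {w | Γ.realizationVertex w ∈
      connectedComponentIn (K i)ᶜ (Γ.realizationVertex v)} ∈ l) :
    ∃ U ∈ FreudenthalEnds K, l ≤ endFilter U := by
  choose v hv using hl
  refine ⟨fun i => connectedComponentIn (K i)ᶜ (Γ.realizationVertex (v i)), ⟨?_, fun i => ?_⟩, ?_⟩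
  · intro i j hij
    -- Two members of a proper filter meet; a common vertex as base point for both components makes
    -- them nested.
    obtain ⟨w, hwi, hwj⟩ := l.nonempty_of_mem (inter_mem (hv i) (hv j))
    change connectedComponentIn _ _ ⊆ connectedComponentIn _ _
    rw [connectedComponentIn_eq hwi, connectedComponentIn_eq hwj]
    exact connectedComponentIn_mono _ (compl_subset_compl.2 (K.subset hij))
  · obtain ⟨w, hw⟩ := l.nonempty_of_mem (hv i)
    exact ⟨_, connectedComponentIn_nonempty_iff.1 ⟨_, hw⟩, rfl⟩
  · exact le_iInf fun i => le_principal_iff.2 (hv i)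

end SimpleGraph

/-! ### Proper left-invariant metrics and Cayley graphs -/

theorem Subgroup.countable_of_closure_eq_top {G : Type*} [Group G] {S : Set G} (hS : S.Countable)
    (h : Subgroup.closure S = ⊤) : Countable G := by
  have := hS.to_subtype
  have : Function.Surjective (FreeGroup.lift ((↑) : S → G)) := by
    rw [← MonoidHom.range_eq_top, FreeGroup.range_lift_eq_closure, Subtype.range_coe, h]
  exact this.countable

/-- By Baire, one of the countably many singletons has nonempty interior, and left translations,
being isometries, carry its isolating ball to every point. -/
theorem discreteTopology_of_dist_mul_left {G : Type*} [Group G] [MetricSpace G] [ProperSpace G]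
    [Countable G] (left_inv : ∀ g x y : G, dist (g * x) (g * y) = dist x y) :
    DiscreteTopology G := by
  obtain ⟨a, ha⟩ := nonempty_interior_of_iUnion_of_closed (fun a : G => isClosed_singleton (x := a))
    (iUnion_of_singleton G)
  obtain ⟨b, hb⟩ := ha
  obtain ⟨ε, hε, hball⟩ := Metric.mem_nhds_iff.1 (mem_interior_iff_mem_nhds.1 hb)
  obtain rfl : b = a := interior_subset (s := {a}) hb
  refine discreteTopology_iff_isOpen_singleton.2 fun x => Metric.isOpen_iff.2 fun y hy => ?_
  refine ⟨ε, hε, fun z hz => ?_⟩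
  rw [mem_singleton_iff] at hy
  subst hy
  have : b * y⁻¹ * z ∈ Metric.ball b ε := by
    rw [Metric.mem_ball] at hz ⊢
    rw [← left_inv (b * y⁻¹)] at hz
    simpa using hz
  have h := hball this
  rw [mem_singleton_iff, mul_assoc, mul_eq_left, inv_mul_eq_one] at h
  exact h.symm

theorem Bornology.IsBounded.finite_of_discrete {X : Type*} [MetricSpace X] [ProperSpace X]
    [DiscreteTopology X] {B : Set X} (hB : Bornology.IsBounded B) : B.Finite :=
  hB.isCompact_closure.finite_of_discrete.subset subset_closure

theorem SimpleGraph.finite_neighborSet_mulCayley {G : Type*} [Group G] {S : Set G} (hS : S.Finite)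
    (v : G) : ((mulCayley S).neighborSet v).Finite := by
  refine ((hS.image (v * ·)).union (hS.image (v * ·⁻¹))).subset fun w hw => ?_
  obtain ⟨-, s, hs, h | h⟩ := (mulCayley_adj' S v w).1 hw
  · exact Or.inl ⟨s, hs, h⟩
  · exact Or.inr ⟨s, hs, by simp [h]⟩

theorem SimpleGraph.eq_or_mulCayley_adj {G : Type*} [Group G] {S : Set G} (x : G) {s : G}
    (hs : s ∈ S) : x = x * s ∨ (mulCayley S).Adj x (x * s) :=
  or_iff_not_imp_left.2 fun h => (mulCayley_adj' S _ _).2 ⟨h, s, hs, Or.inl rfl⟩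

-- By left invariance the length of an edge depends only on its generator. Positivity of `r` is
-- needed to apply `exhausts`.
open SimpleGraph (mulCayley mulCayley_adj') in
theorem exists_dist_le_of_mulCayley_adj {G : Type*} [Group G] [MetricSpace G]
    (left_inv : ∀ g x y : G, dist (g * x) (g * y) = dist x y) {S : Set G} (hS : S.Finite) :
    ∃ r : ℝ, 0 < r ∧ ∀ x y, (mulCayley S).Adj x y → dist x y ≤ r := by
  obtain ⟨r, hr⟩ := (hS.image (dist 1)).bddAbove
  have key : ∀ x, ∀ s ∈ S, dist x (x * s) ≤ r := fun x s hs => by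
    have := hr (mem_image_of_mem _ hs)
    rwa [← left_inv x, mul_one] at this
  refine ⟨max r 1, by positivity, fun x y hxy => le_max_of_le_left ?_⟩
  obtain ⟨-, s, hs, rfl | rfl⟩ := (mulCayley_adj' S x y).1 hxy
  · exact key x s hs
  · rw [dist_comm]
    exact key y s hs

/-! ### Almost invariant sets and glacially oscillating functions -/

section AlmostInvariant

variable {G : Type*} [Group G]

/-- If right translation by each element of a generating set changes `A` by a finite set, then so
does every right translation. -/
theorem finite_setOf_not_mem_iff_mul_mem {S : Set G} (hS : Subgroup.closure S = ⊤) {A : Set G}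
    (hA : ∀ s ∈ S, {x | ¬(x ∈ A ↔ x * s ∈ A)}.Finite) (g : G) :
    {x | ¬(x ∈ A ↔ x * g ∈ A)}.Finite := by
  have hg : g ∈ Subgroup.closure S := hS ▸ Subgroup.mem_top g
  induction hg using Subgroup.closure_induction with
  | mem s hs => exact hA s hs
  | one => simp
  | mul g h _ _ hg hh =>
    refine (hg.union (hh.preimage (mul_left_injective g).injOn)).subset fun x hx => ?_
    simp only [mem_ofPred_eq, mem_union, mem_preimage, ← mul_assoc] at hx ⊢
    tauto
  | inv g _ hg =>
    refine (hg.preimage (mul_left_injective g⁻¹).injOn).subset fun x hx => ?_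
    simp only [mem_ofPred_eq, mem_preimage, inv_mul_cancel_right] at hx ⊢
    tauto

variable [MetricSpace G] [ProperSpace G] [DiscreteTopology G]

/-- An almost invariant set yields a glacially oscillating function. -/
theorem exists_glacialFunction_indicator
    (left_inv : ∀ g x y : G, dist (g * x) (g * y) = dist x y) {S : Set G}
    (hS : Subgroup.closure S = ⊤) {A : Set G}
    (hA : ∀ s ∈ S, {x | ¬(x ∈ A ↔ x * s ∈ A)}.Finite) :
    ∃ f : GlacialFunction G, (∀ x ∈ A, f.1 x = 1) ∧ ∀ x ∉ A, f.1 x = 0 := by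
  classical
  refine ⟨⟨⟨A.indicator 1, continuous_of_discreteTopology⟩, fun ε hε => ?_⟩,
    fun x hx => indicator_of_mem hx _, fun x hx => indicator_of_notMem hx _⟩
  -- The balls make the scale exhaust $G$. The added finite sets contain every point at which
  -- multiplication by an element of norm at most `i` crosses the boundary of `A`, so no link leaves
  -- or enters `A`.
  let T : GlacialScale G :=
    { K := fun i => Metric.closedBall 1 i ∪
        ⋃ g ∈ Metric.closedBall (1 : G) i, {x | ¬(x ∈ A ↔ x * g ∈ A)}
      n := id
      bounded := fun i => Metric.isBounded_closedBall.union
        (Metric.isBounded_closedBall.finite_of_discrete.biUnion fun g _ =>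
          finite_setOf_not_mem_iff_mul_mem hS hA g).isBounded
      exhausts := fun B hB r _ => by
        obtain ⟨R, hR⟩ := hB.subset_closedBall 1
        obtain ⟨i, hi⟩ := exists_nat_gt (max R r)
        exact ⟨i, fun x hx => Or.inl (Metric.closedBall_subset_closedBall
          ((le_max_left _ _).trans hi.le) (hR hx)), (le_max_right _ _).trans_lt hi⟩ }
  refine ⟨T, fun x y hxy => ?_⟩
  have hiff : x ∈ A ↔ y ∈ A := by
    induction hxy with
    | refl => rfl
    | @tail y z _ hl ih =>
      obtain ⟨m, hy, -, hd⟩ := hl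
      refine ih.trans (not_not.1 fun hne => hy (Or.inr (mem_biUnion (x := y⁻¹ * z) ?_ ?_)))
      · rw [Metric.mem_closedBall, ← left_inv y, dist_comm]
        simpa [T] using hd
      · simpa using hne
  by_cases hx : x ∈ A
  · simpa [hx, hiff.1 hx] using hε
  · simpa [hx, mt hiff.2 hx] using hε

end AlmostInvariant

/-! ### Components of complements in the Cayley graph -/

namespace SimpleGraph

variable {G : Type*} [Group G] {S : Set G}

/-- The vertices in a connected component of the complement of a compact set form an almost
invariant set. -/
theorem finite_setOf_not_mem_component_iff (hS : S.Finite)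
    {C : Set (mulCayley S).geometricRealization} (hC : IsCompact C)
    (p : (mulCayley S).geometricRealization) {s : G} (hs : s ∈ S) :
    {x | ¬((mulCayley S).realizationVertex x ∈ connectedComponentIn Cᶜ p ↔
      (mulCayley S).realizationVertex (x * s) ∈ connectedComponentIn Cᶜ p)}.Finite := by
  refine (finite_setOf_realizationEdge_inter_nonempty (finite_neighborSet_mulCayley hS) hC).subset
    fun x hx => ⟨x * s, eq_or_mulCayley_adj x hs, fun hd => hx ?_⟩
  have h := connectedComponentIn_eq (realizationVertex_mem_connectedComponentIn
    (eq_or_mulCayley_adj x hs) hd (right_mem_realizationEdge x (x * s)))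
  have hx1 := subset_compl_iff_disjoint_right.2 hd (left_mem_realizationEdge x (x * s))
  have hx2 := subset_compl_iff_disjoint_right.2 hd (right_mem_realizationEdge x (x * s))
  constructor <;> intro h'
  · rw [connectedComponentIn_eq h', ← h]
    exact mem_connectedComponentIn hx2
  · rw [connectedComponentIn_eq h', h]
    exact mem_connectedComponentIn hx1

/-- All but finitely many vertices of the Cayley graph lie in finitely many components of the
complement of a compact set. -/
theorem exists_finite_forall_mem_component (hS : S.Finite) (hgen : Subgroup.closure S = ⊤)
    {C : Set (mulCayley S).geometricRealization} (hC : IsCompact C) :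
    ∃ T : Set G, T.Finite ∧ ∀ x, (mulCayley S).realizationVertex x ∉ C → ∃ t ∈ T,
      (mulCayley S).realizationVertex x ∈
        connectedComponentIn Cᶜ ((mulCayley S).realizationVertex t) := by
  -- Follow a word from `1` to `x`: the component changes only across edges meeting `C`, whose
  -- endpoints are in `T`. The element `1` starts the induction.
  set T := insert 1 {x | ∃ y, (x = y ∨ (mulCayley S).Adj x y) ∧
    ¬ Disjoint ((mulCayley S).realizationEdge x y) C}
  refine ⟨T, (finite_setOf_realizationEdge_inter_nonempty
    (finite_neighborSet_mulCayley hS) hC).insert 1, fun x => ?_⟩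
  have step : ∀ x y : G, (x = y ∨ (mulCayley S).Adj x y) →
      ((mulCayley S).realizationVertex x ∉ C → ∃ t ∈ T, (mulCayley S).realizationVertex x ∈
        connectedComponentIn Cᶜ ((mulCayley S).realizationVertex t)) →
      (mulCayley S).realizationVertex y ∉ C → ∃ t ∈ T, (mulCayley S).realizationVertex y ∈
        connectedComponentIn Cᶜ ((mulCayley S).realizationVertex t) := by
    intro x y hxy ih hy
    have hyx : y = x ∨ (mulCayley S).Adj y x := hxy.imp Eq.symm Adj.symm
    by_cases hd : Disjoint ((mulCayley S).realizationEdge y x) C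
    · obtain ⟨t, ht, hx⟩ := ih (subset_compl_iff_disjoint_right.2 hd (right_mem_realizationEdge y x))
      refine ⟨t, ht, ?_⟩
      rw [connectedComponentIn_eq hx]
      exact realizationVertex_mem_connectedComponentIn hyx hd (right_mem_realizationEdge y x)
    · exact ⟨y, Or.inr ⟨x, hyx, hd⟩, mem_connectedComponentIn hy⟩
  have hx : x ∈ Subgroup.closure S := hgen ▸ Subgroup.mem_top x
  induction hx using Subgroup.closure_induction_right with
  | one => exact fun h => ⟨1, mem_insert _ _, mem_connectedComponentIn h⟩
  | mul_right x _ s hs ih => exact step x _ (eq_or_mulCayley_adj x hs) ih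
  | mul_inv_cancel x _ s hs ih =>
    refine step x _ ?_ ih
    have := eq_or_mulCayley_adj (x * s⁻¹) hs
    rw [inv_mul_cancel_right] at this
    exact this.imp Eq.symm Adj.symm

/-- Every point of the corona is a limit along an ultrafilter finer than the filter of some
Freudenthal end. -/
theorem exists_ultrafilter_le_endFilter [MetricSpace G] (hS : S.Finite)
    (hgen : Subgroup.closure S = ⊤)
    (K : CompactExhaustion (mulCayley S).geometricRealization)
    {p : GlacialFunction G → unitInterval} (hp : p ∈ CoarseFreudenthalCorona G) :
    ∃ U ∈ FreudenthalEnds K, ∃ l : Ultrafilter G,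
      Tendsto (glacialEval G) l (𝓝 p) ∧ (l : Filter G) ≤ endFilter U := by
  have hne : (𝓝[range (glacialEval G)] p).NeBot := mem_closure_iff_nhdsWithin_neBot.1 hp.1
  have hne' : (comap (glacialEval G) (𝓝[range (glacialEval G)] p)).NeBot :=
    hne.comap_of_range_mem self_mem_nhdsWithin
  let l := Ultrafilter.of (comap (glacialEval G) (𝓝[range (glacialEval G)] p))
  have hl : Tendsto (glacialEval G) l (𝓝 p) :=
    (tendsto_comap.mono_left (Ultrafilter.of_le _)).mono_right nhdsWithin_le_nhds
  -- A principal ultrafilter would converge to a point of the image of $G$.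
  have hcof : (l : Filter G) ≤ cofinite := by
    refine le_cofinite_iff_compl_singleton_mem.2 fun x => ?_
    refine Ultrafilter.compl_mem_iff_notMem.2 fun hx => hp.2 ⟨x, ?_⟩
    refine tendsto_nhds_unique (tendsto_const_nhds.congr' ?_) hl
    exact mem_of_superset hx fun y hy => congrArg _ (mem_singleton_iff.1 hy).symm
  obtain ⟨U, hU, hle⟩ := exists_freudenthalEnd_of_le (K := K) (l := (l : Filter G)) fun i => by
    obtain ⟨T, hT, hcover⟩ := exists_finite_forall_mem_component hS hgen (K.isCompact i)
    have hmem : {x | (mulCayley S).realizationVertex x ∈ K i}ᶜ ∈ l :=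
      hcof (((finite_setOf_realizationEdge_inter_nonempty (finite_neighborSet_mulCayley hS)
        (K.isCompact i)).subset fun x hx => ⟨x, Or.inl rfl, not_disjoint_iff.2
          ⟨_, left_mem_realizationEdge x x, hx⟩⟩).compl_mem_cofinite)
    obtain ⟨t, -, ht⟩ := (Ultrafilter.finite_biUnion_mem_iff hT).1
      (mem_of_superset hmem fun x hx => by
        obtain ⟨t, ht, hxt⟩ := hcover x hx
        exact mem_biUnion (t := fun t => {w | (mulCayley S).realizationVertex w ∈
          connectedComponentIn (K i)ᶜ ((mulCayley S).realizationVertex t)}) ht hxt)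
    exact ⟨t, ht⟩
  exact ⟨U, hU, l, hl, hle⟩

end SimpleGraph

/-! ### The map from ends to corona points -/

section Ends

open SimpleGraph hiding dist

variable {G : Type*} [Group G] [MetricSpace G] [ProperSpace G] [DiscreteTopology G] {S : Set G}
  {K : CompactExhaustion (mulCayley S).geometricRealization}
  {U : ℕ → Set (mulCayley S).geometricRealization}

/-- Along a Freudenthal end of the Cayley graph, every glacially oscillating function converges. -/
theorem exists_tendsto_endFilter (left_inv : ∀ g x y : G, dist (g * x) (g * y) = dist x y)
    (hS : S.Finite) (hU : U ∈ FreudenthalEnds K) (f : GlacialFunction G) :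
    ∃ c, Tendsto f.1 (endFilter U) (𝓝 c) := by
  have hfin := finite_neighborSet_mulCayley hS
  have := endFilter_neBot hfin hU
  refine cauchy_map_iff_exists_tendsto.1 (Metric.cauchy_iff.2 ⟨inferInstance, fun ε hε => ?_⟩)
  obtain ⟨T, hT⟩ := f.2 ε hε
  obtain ⟨r, hr, hdist⟩ := exists_dist_le_of_mulCayley_adj left_inv hS
  -- A single pair of the scale suffices: with `T.n m` exceeding all edge lengths, every edge with
  -- both endpoints outside `T.K m` is a link.
  obtain ⟨m, -, hm⟩ := T.exhausts ∅ Bornology.isBounded_empty r hr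
  obtain ⟨i, hi⟩ := K.exists_superset_of_isCompact
    ((T.bounded m).finite_of_discrete.isCompact_biUnion fun v _ => isCompact_realizationClosedStar hfin v)
  refine ⟨_, image_mem_map (endVertices_mem_endFilter U i), ?_⟩
  rintro _ ⟨v, hv, rfl⟩ _ ⟨w, hw, rfl⟩
  rw [Subtype.dist_eq, Real.dist_eq]
  refine hT v w (mem_of_isPreconnected_of_disjoint_star (F := T.K m) (A := {x | T.Joined v x})
    (fun x hx y hxF hyF hxy => hx.tail ⟨m, hxF, hyF, (hdist x y hxy).trans hm.le⟩)
    (U := U i) ?_ (fun u hu => ?_) Relation.ReflTransGen.refl hv hw)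
  · rw [FreudenthalEnds.eq_connectedComponentIn hU hv]
    exact isPreconnected_connectedComponentIn
  · exact (disjoint_compl_left.mono_right (((realizationStar_subset_closedStar u).trans
      (subset_biUnion_of_mem (u := fun v => realizationClosedStar _ v) hu)).trans hi)).mono_left
      (FreudenthalEnds.subset_compl hU i)

/-- The point of the cube given by the limits of the glacially oscillating functions along a
Freudenthal end lies in the corona. -/
theorem mem_corona_of_tendsto_endFilter
    (left_inv : ∀ g x y : G, dist (g * x) (g * y) = dist x y) (hS : S.Finite)
    (hgen : Subgroup.closure S = ⊤) (hU : U ∈ FreudenthalEnds K)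
    {p : GlacialFunction G → unitInterval} (hp : ∀ f, Tendsto f.1 (endFilter U) (𝓝 (p f))) :
    p ∈ CoarseFreudenthalCorona G := by
  have := endFilter_neBot (finite_neighborSet_mulCayley hS) hU
  refine ⟨mem_closure_of_tendsto (tendsto_pi_nhds.2 hp)
    (Eventually.of_forall fun x => mem_range_self x), ?_⟩
  rintro ⟨x, rfl⟩
  -- Singletons are almost invariant: translation by `s` affects at most `x` and `x * s⁻¹`.
  obtain ⟨f, hf1, hf0⟩ := exists_glacialFunction_indicator left_inv hgen (A := {x}) fun s _ => by
    refine (Set.toFinite {x, x * s⁻¹}).subset fun y hy => ?_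
    simp only [mem_ofPred_eq, mem_singleton_iff, mem_insert_iff, eq_mul_inv_iff_mul_eq] at hy ⊢
    tauto
  have h0 : Tendsto f.1 (endFilter U) (𝓝 0) := tendsto_const_nhds.congr' <|
    mem_of_superset (compl_singleton_mem_endFilter hU x) fun y hy => (hf0 y hy).symm
  have h1 : f.1 x = 0 := tendsto_nhds_unique (hp f) h0
  rw [hf1 x rfl] at h1
  exact one_ne_zero h1

/-- A Freudenthal end is determined by the limits of the glacially oscillating functions. -/
theorem freudenthalEnd_eq_of_tendsto
    (left_inv : ∀ g x y : G, dist (g * x) (g * y) = dist x y) (hS : S.Finite)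
    (hgen : Subgroup.closure S = ⊤) {U' : ℕ → Set (mulCayley S).geometricRealization}
    (hU : U ∈ FreudenthalEnds K) (hU' : U' ∈ FreudenthalEnds K)
    {p : GlacialFunction G → unitInterval} (hp : ∀ f, Tendsto f.1 (endFilter U) (𝓝 (p f)))
    (hp' : ∀ f, Tendsto f.1 (endFilter U') (𝓝 (p f))) : U = U' := by
  have := endFilter_neBot (finite_neighborSet_mulCayley hS) hU
  have := endFilter_neBot (finite_neighborSet_mulCayley hS) hU'
  funext i
  by_contra hne
  obtain ⟨f, hf1, hf0⟩ := exists_glacialFunction_indicator left_inv hgen (A := endVertices U i)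
    fun s hs => by
      obtain ⟨x, -, hx⟩ := hU.2 i
      simpa only [endVertices, hx, mem_ofPred_eq] using
        finite_setOf_not_mem_component_iff hS (K.isCompact i) x hs
  have h1 : Tendsto f.1 (endFilter U) (𝓝 1) := tendsto_const_nhds.congr' <|
    mem_of_superset (endVertices_mem_endFilter U i) fun y hy => (hf1 y hy).symm
  have h0 : Tendsto f.1 (endFilter U') (𝓝 0) := tendsto_const_nhds.congr' <|
    -- If `U i` and `U' i` differ they share no vertex, being components of the same set.
    mem_of_superset (endVertices_mem_endFilter U' i) fun y hy => (hf0 y fun hy' => hne <| by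
      rw [FreudenthalEnds.eq_connectedComponentIn hU hy',
        FreudenthalEnds.eq_connectedComponentIn hU' hy]).symm
  exact one_ne_zero ((tendsto_nhds_unique h1 (hp f)).trans (tendsto_nhds_unique (hp' f) h0))

end Ends

theorem proposition5p4 {G : Type*} [Group G] [MetricSpace G] [ProperSpace G]
    (left_inv : ∀ g x y : G, dist (g * x) (g * y) = dist x y)
    (S : Set G) (S_finite : S.Finite) (S_generates : Subgroup.closure S = ⊤) :
    Nonempty (CompactExhaustion (SimpleGraph.mulCayley S).geometricRealization) ∧
      ∀ K : CompactExhaustion (SimpleGraph.mulCayley S).geometricRealization,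
        numberOfEnds G = Cardinal.mk (FreudenthalEnds K) := by
  have : Countable G := Subgroup.countable_of_closure_eq_top S_finite.countable S_generates
  have : DiscreteTopology G := discreteTopology_of_dist_mul_left left_inv
  refine ⟨SimpleGraph.nonempty_compactExhaustion_geometricRealization
    (SimpleGraph.finite_neighborSet_mulCayley S_finite), fun K => ?_⟩
  choose lim hlim using fun U : FreudenthalEnds K =>
    exists_tendsto_endFilter left_inv S_finite U.2
  refine (Cardinal.mk_congr (Equiv.ofBijective (fun U => (⟨lim U,
    mem_corona_of_tendsto_endFilter left_inv S_finite S_generates U.2 (hlim U)⟩ :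
      CoarseFreudenthalCorona G)) ⟨fun U U' h => ?_, fun p => ?_⟩)).symm
  · have h' : lim U = lim U' := congrArg Subtype.val h
    exact Subtype.ext (freudenthalEnd_eq_of_tendsto left_inv S_finite S_generates U.2 U'.2
      (hlim U) fun f => h' ▸ hlim U' f)
  -- The limit along the end's filter is also the limit along the finer ultrafilter, hence is `p`.
  · obtain ⟨U, hU, l, hl, hle⟩ := SimpleGraph.exists_ultrafilter_le_endFilter S_finite
      S_generates K p.2
    exact ⟨⟨U, hU⟩, Subtype.ext (funext fun f => tendsto_nhds_unique
      ((hlim ⟨U, hU⟩ f).mono_left hle) (tendsto_pi_nhds.1 hl f))⟩
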